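/- Let $n,m$ be positive integers, let $\Phi:\mathbb{M}_n\to\mathbb{M}_m$ be a positive linear map between spaces of complex square matrices (that is, $\Phi$ is $\mathbb{C}$-linear and maps positive semi-definite matrices to positive semi-definite matrices), and let $N\in\mathbb{M}_n$ be normal. Write $|X|=(X^*X)^{1/2}$, and for a Hermitian $A\in\mathbb{M}_m$ let $\lambda_1(A)\ge\cdots\ge\lambda_m(A)$ be its eigenvalues in decreasing order, counted with multiplicity, with the convention $\lambda_j(A)=0$ for $j>m$. Then: (a) $|\Phi(N)|$ is weakly log-majorised by $\Phi(|N|)$, i.e. $\prod_{i=1}^{k}\lambda_i(|\Phi(N)|)\le\prod_{i=1}^{k}\lambda_i(\Phi(|N|))$ for every $k=1,\dots,m$; (b) for all integers $j,k\ge1$, $\lambda_{j+k-1}(|\Phi(N)|)\le\sqrt{\lambda_j(\Phi(|N|))\,\lambda_k(\Phi(|N|))}$; (c) for all real $\beta>0$ and all integers $j\ge1$, $4\beta\,\lambda_j\bigl(|\Phi(N)|-\beta\,\Phi(|N|)\bigr)\le\lambda_j(\Phi(|N|))$. -/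

import Mathlib

open scoped ComplexOrder MatrixOrder

/-- The `j`-th largest eigenvalue `λ_j(A)` (counted with multiplicity, `1 ≤ j ≤ m`) of a Hermitian
matrix `A` of size `m`, so that `λ_1(A) ≥ λ_2(A) ≥ ⋯ ≥ λ_m(A)`. Indices start at `1`; the usual
convention `λ_j(A) = 0` is used for `j > m` (and for the meaningless index `j = 0`). -/
noncomputable def orderedEigenvalue {m : ℕ} (A : Matrix (Fin m) (Fin m) ℂ) (hA : A.IsHermitian)
    (j : ℕ) : ℝ :=
  if h : 1 ≤ j ∧ j ≤ m then
    hA.eigenvalues₀ ⟨j - 1, by rw [Fintype.card_fin]; omega⟩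
  else 0

/-- Weak log-majorisation `A ≺_{w log} B` of positive semi-definite matrices of size `m`:
`∏_{i ≤ k} λ_i(A) ≤ ∏_{i ≤ k} λ_i(B)` for `k = 1, …, m`. -/
def WeakLogMajorized {m : ℕ} (A B : Matrix (Fin m) (Fin m) ℂ) (hA : A.PosSemidef)
    (hB : B.PosSemidef) : Prop :=
  ∀ k : ℕ, 1 ≤ k → k ≤ m →
    ∏ i ∈ Finset.Icc 1 k, orderedEigenvalue A hA.isHermitian i ≤
      ∏ i ∈ Finset.Icc 1 k, orderedEigenvalue B hB.isHermitian i

/-- `|A| = (A* A)^{1/2}` is positive semi-definite. -/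
theorem posSemidef_abs {m : ℕ} (A : Matrix (Fin m) (Fin m) ℂ) : (CFC.abs A).PosSemidef :=
  Matrix.nonneg_iff_posSemidef.mp (CFC.abs_nonneg A)

/-- `Φ(|N|)` is positive semi-definite for a positive linear map `Φ`. -/
theorem posSemidef_map_abs {n m : ℕ}
    (Φ : Matrix (Fin n) (Fin n) ℂ →ₚ[ℂ] Matrix (Fin m) (Fin m) ℂ)
    (N : Matrix (Fin n) (Fin n) ℂ) : (Φ (CFC.abs N)).PosSemidef :=
  Matrix.nonneg_iff_posSemidef.mp (by simpa using OrderHomClass.mono Φ (CFC.abs_nonneg N))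

/-- `|Φ(N)| - β Φ(|N|)` is Hermitian for real `β`. -/
theorem isHermitian_abs_map_sub_smul {n m : ℕ}
    (Φ : Matrix (Fin n) (Fin n) ℂ →ₚ[ℂ] Matrix (Fin m) (Fin m) ℂ)
    (N : Matrix (Fin n) (Fin n) ℂ) (β : ℝ) :
    (CFC.abs (Φ N) - β • Φ (CFC.abs N)).IsHermitian :=
  (posSemidef_abs (Φ N)).isHermitian.sub
    (((posSemidef_map_abs Φ N).isHermitian).smul (IsSelfAdjoint.all β))

/-! ### Eigenvalue comparison by min-max and dimension counting. -/

section EigenvalueInequalities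

variable {E F : Type*} [NormedAddCommGroup E] [InnerProductSpace ℂ E] [FiniteDimensional ℂ E]
  [NormedAddCommGroup F] [InnerProductSpace ℂ F] [FiniteDimensional ℂ F]

/-! Write `N = ∑ z Q_z` and `|N| = ∑ |z| Q_z` with `Q_z ≥ 0`. Since `Φ(Q_z) ≥ 0`, Cauchy–Schwarz for
each form `Φ(Q_z)` and then over the sum gives `|⟨x, Φ(N) y⟩|² ≤ ⟨x, B x⟩⟨y, B y⟩` with `B = Φ(|N|)`
(`norm_inner_map_sq_le`). The polar decomposition `Φ(N) = U P`, `P = |Φ(N)|`, turns this into `|⟨x,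
P y⟩|² ≤ ⟨Ux, B Ux⟩⟨y, B y⟩`. All three claims follow from this one bound: (b) by choosing `x = y`
in an intersection of spectral subspaces, (c) by AM-GM and monotonicity of eigenvalues, (a) by
compressing to the top `k` eigenvectors of `P` and comparing determinants through a Schur
complement. -/

theorem LinearMap.IsSymmetric.re_inner_apply_eq_sum {T : E →ₗ[ℂ] E} (hT : T.IsSymmetric) {n : ℕ}
    (hn : Module.finrank ℂ E = n) (x : E) :
    (inner ℂ x (T x)).re =
      ∑ i, hT.eigenvalues hn i * ‖inner ℂ (hT.eigenvectorBasis hn i) x‖ ^ 2 := by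
  rw [← (hT.eigenvectorBasis hn).sum_inner_mul_inner x (T x), Complex.re_sum]
  refine Finset.sum_congr rfl fun i _ => ?_
  rw [← hT, hT.apply_eigenvectorBasis, inner_smul_left, ← inner_conj_symm x,
    mul_left_comm, Complex.conj_mul']
  simp [← Complex.ofReal_pow, -Complex.ofReal_mul, ← Complex.ofReal_mul]

theorem LinearMap.IsSymmetric.re_inner_apply_le {T : E →ₗ[ℂ] E} (hT : T.IsSymmetric) {n : ℕ}
    (hn : Module.finrank ℂ E = n) (i : Fin n) {x : E}
    (hx : ∀ k < i, inner ℂ (hT.eigenvectorBasis hn k) x = 0) :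
    (inner ℂ x (T x)).re ≤ hT.eigenvalues hn i * ‖x‖ ^ 2 := by
  rw [hT.re_inner_apply_eq_sum hn, ← (hT.eigenvectorBasis hn).sum_sq_norm_inner_right x,
    Finset.mul_sum]
  refine Finset.sum_le_sum fun k _ => ?_
  rcases lt_or_ge k i with h | h
  · simp [hx k h]
  · gcongr
    exact hT.eigenvalues_antitone hn h

theorem LinearMap.IsSymmetric.le_re_inner_apply {T : E →ₗ[ℂ] E} (hT : T.IsSymmetric) {n : ℕ}
    (hn : Module.finrank ℂ E = n) (i : Fin n) {x : E}
    (hx : ∀ k > i, inner ℂ (hT.eigenvectorBasis hn k) x = 0) :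
    hT.eigenvalues hn i * ‖x‖ ^ 2 ≤ (inner ℂ x (T x)).re := by
  rw [hT.re_inner_apply_eq_sum hn, ← (hT.eigenvectorBasis hn).sum_sq_norm_inner_right x,
    Finset.mul_sum]
  refine Finset.sum_le_sum fun k _ => ?_
  rcases lt_or_ge i k with h | h
  · simp [hx k h]
  · gcongr
    exact hT.eigenvalues_antitone hn h

theorem LinearMap.IsSymmetric.re_inner_eigenvectorBasis {T : E →ₗ[ℂ] E} (hT : T.IsSymmetric)
    {n : ℕ} (hn : Module.finrank ℂ E = n) (i : Fin n) :
    (inner ℂ (hT.eigenvectorBasis hn i) (T (hT.eigenvectorBasis hn i))).re =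
      hT.eigenvalues hn i := by
  simp [hT.apply_eigenvectorBasis]

theorem LinearMap.IsSymmetric.eigenvalues_nonneg_of_re_inner_nonneg {T : E →ₗ[ℂ] E}
    (hT : T.IsSymmetric) {n : ℕ} (hn : Module.finrank ℂ E = n)
    (h : ∀ x, 0 ≤ (inner ℂ x (T x)).re) (i : Fin n) : 0 ≤ hT.eigenvalues hn i :=
  hT.re_inner_eigenvectorBasis hn i ▸ h _

theorem exists_ne_zero_forall_apply_eq_zero {ι : Type*} [Fintype ι] (f : ι → E →ₗ[ℂ] ℂ)
    (h : Fintype.card ι < Module.finrank ℂ E) : ∃ x : E, x ≠ 0 ∧ ∀ i, f i x = 0 := by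
  have := LinearMap.ker_ne_bot_of_finrank_lt (f := LinearMap.pi f) (by simpa using h)
  obtain ⟨x, hx, hx0⟩ := Submodule.exists_mem_ne_zero_of_ne_bot this
  exact ⟨x, hx0, fun i => congrFun (LinearMap.mem_ker.mp hx) i⟩

/-- Comparison of eigenvalues: if the quadratic form of `A` is dominated by `c` times that of `B`
along an isometry, then `λ_i(A) ≤ c λ_i(B)`. -/
theorem LinearMap.IsSymmetric.eigenvalues_le_mul {A : F →ₗ[ℂ] F} {B : E →ₗ[ℂ] E}
    (hA : A.IsSymmetric) (hB : B.IsSymmetric) {k m : ℕ} (hk : Module.finrank ℂ F = k)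
    (hm : Module.finrank ℂ E = m) (V : F →ₗᵢ[ℂ] E) {c : ℝ} (hc : 0 ≤ c)
    (h : ∀ x, (inner ℂ x (A x)).re ≤ c * (inner ℂ (V x) (B (V x))).re)
    {i : ℕ} (hik : i < k) (him : i < m) :
    hA.eigenvalues hk ⟨i, hik⟩ ≤ c * hB.eigenvalues hm ⟨i, him⟩ := by
  -- There are `(k - 1 - i) + i = k - 1` linear conditions in dimension `k`.
  obtain ⟨x, hx0, hx⟩ := exists_ne_zero_forall_apply_eq_zero (E := F)
    (Sum.elim (fun q : Finset.Ioi (⟨i, hik⟩ : Fin k) => innerₛₗ ℂ (hA.eigenvectorBasis hk q))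
      (fun q : Finset.Iio (⟨i, him⟩ : Fin m) =>
        (innerₛₗ ℂ (hB.eigenvectorBasis hm q)) ∘ₗ V.toLinearMap))
    (by simp only [hk, Fintype.card_sum, Fintype.card_coe, Fin.card_Ioi, Fin.card_Iio]; omega)
  have h1 := hA.le_re_inner_apply hk ⟨i, hik⟩ (x := x)
    fun q hq => hx (Sum.inl ⟨q, Finset.mem_Ioi.mpr hq⟩)
  have h2 := hB.re_inner_apply_le hm ⟨i, him⟩ (x := V x)
    fun q hq => hx (Sum.inr ⟨q, Finset.mem_Iio.mpr hq⟩)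
  rw [V.norm_map] at h2
  have hpos : 0 < ‖x‖ ^ 2 := by positivity
  refine le_of_mul_le_mul_right ?_ hpos
  calc _ ≤ _ := h1.trans (h x)
    _ ≤ _ := mul_le_mul_of_nonneg_left h2 hc
    _ = _ := by ring

/-! ### Consequences of the bound `|⟨x, P y⟩|² ≤ ⟨Ux, B Ux⟩⟨y, B y⟩`. -/

variable {P B : E →ₗ[ℂ] E} (hP : P.IsSymmetric) (hB : B.IsSymmetric) (U : E →ₗᵢ[ℂ] E)
  {m : ℕ} (hm : Module.finrank ℂ E = m)

theorem eigenvalues_add_le_sqrt_mul (hB0 : ∀ x, 0 ≤ (inner ℂ x (B x)).re)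
    (h : ∀ x y, ‖inner ℂ x (P y)‖ ^ 2 ≤
      (inner ℂ (U x) (B (U x))).re * (inner ℂ y (B y)).re)
    {j k : ℕ} (hjk : j + k < m) :
    hP.eigenvalues hm ⟨j + k, hjk⟩ ≤
      √(hB.eigenvalues hm ⟨j, by omega⟩ * hB.eigenvalues hm ⟨k, by omega⟩) := by
  -- With 0-based indices the conditions number `(m - 1 - j - k) + j + k = m - 1`; those on `Ux` and
  -- on `x` bound the two factors separately.
  obtain ⟨x, hx0, hx⟩ := exists_ne_zero_forall_apply_eq_zero (E := E)
    (Sum.elim (fun q : Finset.Ioi (⟨j + k, hjk⟩ : Fin m) => innerₛₗ ℂ (hP.eigenvectorBasis hm q))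
      (Sum.elim
        (fun q : Finset.Iio (⟨j, by omega⟩ : Fin m) =>
          (innerₛₗ ℂ (hB.eigenvectorBasis hm q)) ∘ₗ U.toLinearMap)
        (fun q : Finset.Iio (⟨k, by omega⟩ : Fin m) => innerₛₗ ℂ (hB.eigenvectorBasis hm q))))
    (by simp only [hm, Fintype.card_sum, Fintype.card_coe, Fin.card_Ioi, Fin.card_Iio]; omega)
  have h1 := hP.le_re_inner_apply hm ⟨j + k, hjk⟩ (x := x)
    fun q hq => hx (Sum.inl ⟨q, Finset.mem_Ioi.mpr hq⟩)
  have h2 := hB.re_inner_apply_le hm ⟨j, by omega⟩ (x := U x)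
    fun q hq => hx (Sum.inr (Sum.inl ⟨q, Finset.mem_Iio.mpr hq⟩))
  have h3 := hB.re_inner_apply_le hm ⟨k, by omega⟩ (x := x)
    fun q hq => hx (Sum.inr (Sum.inr ⟨q, Finset.mem_Iio.mpr hq⟩))
  rw [U.norm_map] at h2
  have hpos : 0 < ‖x‖ ^ 2 := by positivity
  refine le_of_mul_le_mul_right ?_ hpos
  calc _ ≤ ‖inner ℂ x (P x)‖ := h1.trans (Complex.re_le_norm _)
    _ ≤ √((inner ℂ (U x) (B (U x))).re * (inner ℂ x (B x)).re) := Real.le_sqrt_of_sq_le (h x x)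
    _ ≤ √((hB.eigenvalues hm ⟨j, by omega⟩ * ‖x‖ ^ 2) *
          (hB.eigenvalues hm ⟨k, by omega⟩ * ‖x‖ ^ 2)) := by
        refine Real.sqrt_le_sqrt (mul_le_mul h2 h3 (hB0 _) ((hB0 _).trans h2))
    _ = _ := by
        rw [mul_mul_mul_comm, Real.sqrt_mul' _ (by positivity), Real.sqrt_mul_self hpos.le]

/-- AM-GM yields `4β(P - βB) ≤ U*BU` as forms, and `U` is an isometry. -/
theorem eigenvalues_sub_smul_le {β : ℝ} (hβ : 0 < β) (hB0 : ∀ x, 0 ≤ (inner ℂ x (B x)).re)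
    (h : ∀ x y, ‖inner ℂ x (P y)‖ ^ 2 ≤
      (inner ℂ (U x) (B (U x))).re * (inner ℂ y (B y)).re)
    {A : E →ₗ[ℂ] E} (hA : A.IsSymmetric) (hAP : A = P - (β : ℂ) • B) (j : Fin m) :
    4 * β * hA.eigenvalues hm j ≤ hB.eigenvalues hm j := by
  have key := hA.eigenvalues_le_mul hB hm hm U (c := 1 / (4 * β)) (by positivity) (i := j)
    (fun x => ?_) j.2 j.2
  · rw [one_div, ← div_eq_inv_mul, le_div_iff₀ (by positivity)] at key
    linarith
  · have h1 : (inner ℂ x (P x)).re ^ 2 ≤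
        (inner ℂ (U x) (B (U x))).re * (inner ℂ x (B x)).re := by
      refine le_trans ?_ (h x x)
      rw [← sq_abs]
      gcongr
      exact Complex.abs_re_le_norm _
    have h2 := hB0 (U x)
    have h3 := hB0 x
    simp only [hAP, LinearMap.sub_apply, LinearMap.smul_apply, inner_sub_right, inner_smul_right,
      Complex.sub_re, Complex.re_ofReal_mul]
    rw [one_div, ← div_eq_inv_mul, le_div_iff₀ (by positivity)]
    set a := (inner ℂ (U x) (B (U x))).re
    set b := (inner ℂ x (B x)).re
    set p := (inner ℂ x (P x)).re
    have : 4 * β * p ≤ a + 4 * β ^ 2 * b := by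
      refine abs_le_of_sq_le_sq' ?_ (by positivity) |>.2
      nlinarith [sq_nonneg (a - 4 * β ^ 2 * b), mul_le_mul_of_nonneg_left h1 (sq_nonneg β)]
    linarith

/-- On the span of the top `k` eigenvectors of `P`, let `D`, `H` be the compressions of `P`, `B`.
Then `K = D H⁻¹ D` is dominated by the compression of `U*BU`, so the eigenvalues of both `H` and `K`
lie below those of `B`, while `det D ^ 2 = det K * det H`. -/
theorem prod_eigenvalues_le (hP0 : ∀ x, 0 ≤ (inner ℂ x (P x)).re)
    (hB0 : ∀ x, 0 ≤ (inner ℂ x (B x)).re)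
    (h : ∀ x y, ‖inner ℂ x (P y)‖ ^ 2 ≤
      (inner ℂ (U x) (B (U x))).re * (inner ℂ y (B y)).re)
    {k : ℕ} (hk : k ≤ m) :
    ∏ i : Fin k, hP.eigenvalues hm (Fin.castLE hk i) ≤
      ∏ i : Fin k, hB.eigenvalues hm (Fin.castLE hk i) := by
  have hp0 := hP.eigenvalues_nonneg_of_re_inner_nonneg hm hP0
  have hb0 := hB.eigenvalues_nonneg_of_re_inner_nonneg hm hB0
  set p : Fin k → ℝ := fun i => hP.eigenvalues hm (Fin.castLE hk i) with hp
  -- A zero eigenvalue makes the left side vanish; otherwise `D` is invertible, which forces `H` to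
  -- be.
  by_cases hz : ∃ i, p i = 0
  · obtain ⟨i, hi⟩ := hz
    rw [Finset.prod_eq_zero (Finset.mem_univ i) hi]
    exact Finset.prod_nonneg fun i _ => hb0 _
  push Not at hz
  -- The compression to the span of the first `k` eigenvectors of `P`.
  let e := EuclideanSpace.basisFun (Fin k) ℂ
  let v : Fin k → E := fun i => hP.eigenvectorBasis hm (Fin.castLE hk i)
  have hv : Orthonormal ℂ v :=
    (hP.eigenvectorBasis hm).orthonormal.comp _ (Fin.castLE_injective hk)
  have hcomp : e.toBasis.constr ℂ v ∘ e.toBasis = v := by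
    ext1 i; exact e.toBasis.constr_basis ℂ v i
  let V : EuclideanSpace ℂ (Fin k) →ₗᵢ[ℂ] E :=
    LinearMap.isometryOfOrthonormal (e.toBasis.constr ℂ v) (v := e.toBasis)
      (by simp) (by rw [hcomp]; exact hv)
  have hVe : ∀ i, V (e i) = v i := fun i => by
    simpa only [Function.comp_apply, e.coe_toBasis] using! congrFun hcomp i
  let D := Matrix.toLin e.toBasis e.toBasis (Matrix.diagonal fun i => (p i : ℂ))
  have hDe : ∀ i, D (e i) = (p i : ℂ) • e i := fun i => by
    have := Matrix.toLin_self e.toBasis e.toBasis (Matrix.diagonal fun i => (p i : ℂ)) i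
    simpa [Matrix.diagonal_apply] using this
  have hDdet : LinearMap.det D = ((∏ i, p i : ℝ) : ℂ) := by
    simp [D, LinearMap.det_toLin]
  have hPV : ∀ y, P (V y) = V (D y) := by
    intro y
    have : P ∘ₗ V.toLinearMap = V.toLinearMap ∘ₗ D := e.toBasis.ext fun i => by
      simp only [LinearMap.comp_apply, LinearIsometry.coe_toLinearMap, e.coe_toBasis, hDe, map_smul,
        hVe]
      exact hP.apply_eigenvectorBasis hm _
    exact LinearMap.congr_fun this y
  have hD : D.IsSymmetric := fun x y => by
    rw [← V.inner_map_map, ← V.inner_map_map, ← hPV, ← hPV, hP]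
  have hDinj : ∀ y, D y = 0 → y = 0 := by
    have hu : IsUnit (LinearMap.det D) := by
      rw [hDdet, isUnit_iff_ne_zero]
      exact_mod_cast Finset.prod_ne_zero_iff.mpr fun i _ => hz i
    have := (LinearMap.isUnit_iff_isUnit_det D).mpr hu
    intro y hy
    exact ((Module.End.isUnit_iff D).mp this).1 (by simpa using hy)
  have hDle : ∀ x y, ‖inner ℂ x (D y)‖ ^ 2 ≤
      (inner ℂ (U (V x)) (B (U (V x)))).re * (inner ℂ (V y) (B (V y))).re := fun x y => by
    rw [← V.inner_map_map, ← hPV]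
    exact h _ _
  let H := LinearMap.adjoint V.toLinearMap ∘ₗ B ∘ₗ V.toLinearMap
  have hH' : ∀ x y, inner ℂ x (H y) = inner ℂ (V x) (B (V y)) := fun x y => by
    simp [H, LinearMap.adjoint_inner_right]
  have hH : H.IsSymmetric := fun x y => by
    rw [hH', ← hB, ← inner_conj_symm, hH', inner_conj_symm]
  have hHinj : Function.Injective H := by
    rw [injective_iff_map_eq_zero]
    intro y hy
    apply hDinj
    have := hDle (D y) y
    rw [← hH' y, hy, inner_zero_right, Complex.zero_re, mul_zero] at this
    have h0 : inner ℂ (D y) (D y) = 0 := by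
      rw [← norm_eq_zero]; exact pow_eq_zero_iff two_ne_zero |>.mp (le_antisymm this (sq_nonneg _))
    exact inner_self_eq_zero.mp h0
  let G := (LinearEquiv.ofInjectiveEndo H hHinj).symm
  have hG : ∀ x, H (G x) = x := fun x =>
    (LinearEquiv.ofInjectiveEndo H hHinj).apply_symm_apply x
  let K := D ∘ₗ G.toLinearMap ∘ₗ D
  have hK' : ∀ x, inner ℂ x (K x) = inner ℂ (V (G (D x))) (B (V (G (D x)))) := fun x => by
    rw [← hH', ← hH, hG]
    exact (hD _ _).symm
  have hK : K.IsSymmetric := fun x y => by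
    change inner ℂ (D (G (D x))) y = inner ℂ x (D (G (D y)))
    rw [hD, ← hD x]
    conv_lhs => rw [← hG (D y)]
    conv_rhs => rw [← hG (D x)]
    rw [hH]
  have hkF : Module.finrank ℂ (EuclideanSpace ℂ (Fin k)) = k := by simp
  have hH0 := hH.eigenvalues_nonneg_of_re_inner_nonneg hkF fun x => by rw [hH']; exact hB0 _
  have hK0 := hK.eigenvalues_nonneg_of_re_inner_nonneg hkF fun x => by rw [hK']; exact hB0 _
  have hHle : ∀ i : Fin k, hH.eigenvalues hkF i ≤ hB.eigenvalues hm (Fin.castLE hk i) :=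
    fun i => by
      exact (hH.eigenvalues_le_mul hB hkF hm V zero_le_one (fun x => by rw [hH', one_mul])
        i.2 (i.2.trans_le hk)).trans_eq (one_mul _)
  have hKle : ∀ i : Fin k, hK.eigenvalues hkF i ≤ hB.eigenvalues hm (Fin.castLE hk i) :=
    fun i => by
      refine (hK.eigenvalues_le_mul hB hkF hm (U.comp V) zero_le_one (fun x => ?_)
        i.2 (i.2.trans_le hk)).trans_eq (one_mul _)
      -- The choice `y = H⁻¹ D x` makes both `⟨x, D y⟩` and `⟨Vy, B Vy⟩` equal to `⟨x, K x⟩`, so one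
      -- factor cancels.
      have h1 := hDle x (G (D x))
      have h2 : inner ℂ x (D (G (D x))) = inner ℂ x (K x) := rfl
      rw [h2, ← hK'] at h1
      have h3 : 0 ≤ (inner ℂ x (K x)).re := by rw [hK']; exact hB0 _
      have h4 := Complex.re_le_norm (inner ℂ x (K x))
      rw [one_mul]
      change _ ≤ (inner ℂ (U (V x)) (B (U (V x)))).re
      rcases h3.eq_or_lt with h5 | h5
      · rw [← h5]; exact hB0 _
      · refine le_of_mul_le_mul_right ?_ h5
        nlinarith
  have hdet : LinearMap.det D * LinearMap.det D = LinearMap.det K * LinearMap.det H := by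
    have : LinearMap.det G.toLinearMap * LinearMap.det H = 1 := by
      rw [← LinearMap.det_comp]
      convert LinearMap.det_id
      ext1 x
      exact (LinearEquiv.ofInjectiveEndo H hHinj).symm_apply_apply x
    simp only [K, LinearMap.det_comp]
    linear_combination -(LinearMap.det D * LinearMap.det D) * this
  rw [hDdet, hK.det_eq_prod_eigenvalues hkF, hH.det_eq_prod_eigenvalues hkF] at hdet
  have hreal : (∏ i, p i) ^ 2 = (∏ i, hK.eigenvalues hkF i) * ∏ i, hH.eigenvalues hkF i := by
    refine Complex.ofReal_injective ?_
    rw [sq]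
    push_cast at hdet ⊢
    exact hdet
  refine abs_le_of_sq_le_sq' ?_ (Finset.prod_nonneg fun i _ => hb0 _) |>.2
  rw [hreal, sq]
  exact mul_le_mul (Finset.prod_le_prod (fun i _ => hK0 i) fun i _ => hKle i)
    (Finset.prod_le_prod (fun i _ => hH0 i) fun i _ => hHle i)
    (Finset.prod_nonneg fun i _ => hH0 i) (Finset.prod_nonneg fun i _ => hb0 _)

/-- Polar decomposition with an isometric factor. -/
theorem exists_linearIsometry_comp_eq {X P : E →ₗ[ℂ] E} (h : ∀ x, ‖X x‖ = ‖P x‖) :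
    ∃ U : E →ₗᵢ[ℂ] E, ∀ x, U (P x) = X x := by
  have hker : LinearMap.ker P ≤ LinearMap.ker X := fun x hx => by
    rw [LinearMap.mem_ker] at hx ⊢
    rw [← norm_eq_zero, h, hx, norm_zero]
  let L : LinearMap.range P →ₗ[ℂ] E :=
    (LinearMap.ker P).liftQ X hker ∘ₗ P.quotKerEquivRange.symm.toLinearMap
  have hL : ∀ x, L ⟨P x, LinearMap.mem_range_self P x⟩ = X x := fun x => by
    have := P.quotKerEquivRange_symm_apply_image x (LinearMap.mem_range_self P x)
    simp [L, this]
  let L' : LinearMap.range P →ₗᵢ[ℂ] E := ⟨L, by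
    rintro ⟨_, x, rfl⟩
    rw [hL, h]; rfl⟩
  exact ⟨L'.extend, fun x => (L'.extend_apply ⟨P x, LinearMap.mem_range_self P x⟩).trans (hL x)⟩

end EigenvalueInequalities

/-! ### Spectral sums, Cauchy–Schwarz under `Φ`, and indexing. -/

section Matrices

open scoped Matrix.Norms.L2Operator in
/-- Spectral decomposition of a normal matrix and of its absolute value. -/
theorem Matrix.exists_eq_sum_smul_of_isStarNormal {n : ℕ} (N : Matrix (Fin n) (Fin n) ℂ)
    (hN : IsStarNormal N) :
    ∃ (s : Finset ℂ) (Q : ℂ → Matrix (Fin n) (Fin n) ℂ), (∀ z, 0 ≤ Q z) ∧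
      N = ∑ z ∈ s, z • Q z ∧ CFC.abs N = ∑ z ∈ s, (‖z‖ : ℂ) • Q z := by
  have hfin : (spectrum ℂ N).Finite := N.finite_spectrum
  have hcont : ∀ f : ℂ → ℂ, ContinuousOn f (spectrum ℂ N) := fun f => hfin.continuousOn f
  -- On the finite spectrum every function is a combination of point indicators; `cfc (δ z) N` is
  -- the spectral projection at `z`.
  let δ : ℂ → ℂ → ℂ := fun z w => if w = z then 1 else 0
  have hsum : ∀ f : ℂ → ℂ, cfc f N = ∑ z ∈ hfin.toFinset, f z • cfc (δ z) N := by
    intro f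
    simp_rw [← cfc_smul _ (δ _) N (hcont _)]
    rw [← cfc_sum _ _ _ fun i _ => hcont _]
    refine cfc_congr fun w hw => ?_
    simp [δ, Finset.sum_apply, hw]
  have hQ : ∀ z, 0 ≤ cfc (δ z) N := fun z => cfc_nonneg fun w _ => by
    by_cases h : w = z <;> simp [δ, h]
  refine ⟨hfin.toFinset, fun z => cfc (δ z) N, hQ, ?_, ?_⟩
  · rw [← hsum fun z => z, cfc_id' ℂ N]
  · rw [← hsum fun z => (‖z‖ : ℂ), CFC.abs]
    refine CFC.sqrt_unique ?_ (cfc_nonneg fun w _ => by simp)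
    rw [← cfc_mul _ _ N (hcont _) (hcont _)]
    conv_rhs => rw [← cfc_id' ℂ N, ← cfc_star, ← cfc_mul _ _ N (hcont _) (hcont _)]
    refine cfc_congr fun w _ => ?_
    simp only [RCLike.star_def, Complex.conj_mul']
    ring

open Matrix in
theorem Matrix.PosSemidef.norm_inner_toEuclideanLin_le {m : ℕ} {A : Matrix (Fin m) (Fin m) ℂ}
    (hA : A.PosSemidef) (x y : EuclideanSpace ℂ (Fin m)) :
    ‖inner ℂ x (toEuclideanLin A y)‖ ≤
      √(inner ℂ x (toEuclideanLin A x)).re * √(inner ℂ y (toEuclideanLin A y)).re := by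
  obtain ⟨S, hS⟩ := CStarAlgebra.nonneg_iff_eq_star_mul_self.mp hA.nonneg
  have key : ∀ x y, inner ℂ x (toEuclideanLin A y) =
      inner ℂ (toEuclideanLin S x) (toEuclideanLin S y) := fun x y => by
    rw [hS, star_eq_conjTranspose, toLpLin_mul_same, toEuclideanLin_conjTranspose_eq_adjoint,
      LinearMap.comp_apply, LinearMap.adjoint_inner_right]
  have hsq : ∀ x, √(inner ℂ x (toEuclideanLin A x)).re = ‖toEuclideanLin S x‖ := fun x => by
    rw [key, inner_self_eq_norm_sq_to_K]
    norm_cast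
    exact Real.sqrt_sq (norm_nonneg _)
  rw [hsq, hsq, key]
  exact norm_inner_le_norm _ _

open Matrix in
theorem norm_inner_map_sq_le {n m : ℕ}
    (Φ : Matrix (Fin n) (Fin n) ℂ →ₚ[ℂ] Matrix (Fin m) (Fin m) ℂ)
    (N : Matrix (Fin n) (Fin n) ℂ) (hN : IsStarNormal N) (x y : EuclideanSpace ℂ (Fin m)) :
    ‖inner ℂ x (toEuclideanLin (Φ N) y)‖ ^ 2 ≤
      (inner ℂ x (toEuclideanLin (Φ (CFC.abs N)) x)).re *
        (inner ℂ y (toEuclideanLin (Φ (CFC.abs N)) y)).re := by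
  obtain ⟨s, Q, hQ, hNs, hNa⟩ := N.exists_eq_sum_smul_of_isStarNormal hN
  have hΦQ : ∀ z, (Φ (Q z)).PosSemidef := fun z =>
    Matrix.nonneg_iff_posSemidef.mp (by simpa using OrderHomClass.mono Φ (hQ z))
  let q : ℂ → EuclideanSpace ℂ (Fin m) → ℝ := fun z x =>
    (inner ℂ x (toEuclideanLin (Φ (Q z)) x)).re
  have hq : ∀ z x, 0 ≤ q z x := fun z x =>
    (isPositive_toEuclideanLin_iff.mpr (hΦQ z)).re_inner_nonneg_right x
  have habs : ∀ x, (inner ℂ x (toEuclideanLin (Φ (CFC.abs N)) x)).re =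
      ∑ z ∈ s, ‖z‖ * q z x := fun x => by
    simp only [hNa, map_sum, map_smul, LinearMap.sum_apply, LinearMap.smul_apply, inner_sum,
      inner_smul_right, Complex.re_sum, Complex.re_ofReal_mul, q]
  have hnn : ∀ x, 0 ≤ ∑ z ∈ s, ‖z‖ * q z x := fun x =>
    Finset.sum_nonneg fun z _ => mul_nonneg (norm_nonneg _) (hq z x)
  rw [habs, habs]
  have key : ‖inner ℂ x (toEuclideanLin (Φ N) y)‖ ≤
      √(∑ z ∈ s, ‖z‖ * q z x) * √(∑ z ∈ s, ‖z‖ * q z y) := by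
    calc ‖inner ℂ x (toEuclideanLin (Φ N) y)‖
        = ‖∑ z ∈ s, z * inner ℂ x (toEuclideanLin (Φ (Q z)) y)‖ := by
          conv_lhs => rw [hNs]
          simp only [map_sum, map_smul, LinearMap.sum_apply, LinearMap.smul_apply, inner_sum,
            inner_smul_right]
      _ ≤ ∑ z ∈ s, ‖z‖ * (√(q z x) * √(q z y)) := by
          refine (norm_sum_le _ _).trans (Finset.sum_le_sum fun z _ => ?_)
          rw [norm_mul]
          gcongr
          exact (hΦQ z).norm_inner_toEuclideanLin_le x y
      _ = ∑ z ∈ s, √(‖z‖ * q z x) * √(‖z‖ * q z y) := by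
          refine Finset.sum_congr rfl fun z _ => ?_
          rw [Real.sqrt_mul (norm_nonneg z), Real.sqrt_mul (norm_nonneg z), mul_mul_mul_comm,
            Real.mul_self_sqrt (norm_nonneg z)]
      _ ≤ _ := Real.sum_sqrt_mul_sqrt_le s (fun z => mul_nonneg (norm_nonneg _) (hq z x))
          fun z => mul_nonneg (norm_nonneg _) (hq z y)
  calc _ ≤ (√(∑ z ∈ s, ‖z‖ * q z x) * √(∑ z ∈ s, ‖z‖ * q z y)) ^ 2 := by gcongr
    _ = _ := by rw [mul_pow, Real.sq_sqrt (hnn x), Real.sq_sqrt (hnn y)]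

open Matrix in
theorem Matrix.norm_toEuclideanLin_abs {m : ℕ} (X : Matrix (Fin m) (Fin m) ℂ)
    (x : EuclideanSpace ℂ (Fin m)) :
    ‖toEuclideanLin X x‖ = ‖toEuclideanLin (CFC.abs X) x‖ := by
  have key : ∀ Y : Matrix (Fin m) (Fin m) ℂ, inner ℂ x (toEuclideanLin (star Y * Y) x) =
      inner ℂ (toEuclideanLin Y x) (toEuclideanLin Y x) := fun Y => by
    rw [star_eq_conjTranspose, toLpLin_mul_same, toEuclideanLin_conjTranspose_eq_adjoint,
      LinearMap.comp_apply, LinearMap.adjoint_inner_right]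
  have h1 := key (CFC.abs X)
  rw [(CFC.abs_nonneg X).isSelfAdjoint.star_eq, CFC.abs_mul_abs, key X,
    inner_self_eq_norm_sq_to_K, inner_self_eq_norm_sq_to_K] at h1
  norm_cast at h1
  exact (sq_eq_sq₀ (norm_nonneg _) (norm_nonneg _)).mp (mod_cast h1)

theorem orderedEigenvalue_eq_eigenvalues {m : ℕ} {A : Matrix (Fin m) (Fin m) ℂ}
    (hA : A.IsHermitian) (hm : Module.finrank ℂ (EuclideanSpace ℂ (Fin m)) = m) (i : ℕ)
    (hi : i < m) :
    orderedEigenvalue A hA (i + 1) =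
      (Matrix.isSymmetric_toEuclideanLin_iff.mpr hA).eigenvalues hm ⟨i, hi⟩ := by
  -- `eigenvalues₀` is indexed by `Fin (Fintype.card (Fin m))`; a variable dimension `r` allows
  -- substitution.
  have aux : ∀ (r : ℕ) (hr : Module.finrank ℂ (EuclideanSpace ℂ (Fin m)) = r) (h : i < r),
      (Matrix.isSymmetric_toEuclideanLin_iff.mpr hA).eigenvalues hr ⟨i, h⟩ =
      (Matrix.isSymmetric_toEuclideanLin_iff.mpr hA).eigenvalues hm ⟨i, hi⟩ := by
    intro r hr h
    obtain rfl : r = m := hr.symm.trans hm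
    rfl
  rw [orderedEigenvalue, dif_pos ⟨by omega, by omega⟩]
  exact aux _ _ _

theorem orderedEigenvalue_of_lt {m : ℕ} {A : Matrix (Fin m) (Fin m) ℂ}
    (hA : A.IsHermitian) {j : ℕ} (hj : m < j) : orderedEigenvalue A hA j = 0 :=
  dif_neg (by omega)

end Matrices

/-! ### Assembly of the three inequalities. -/

theorem corollary2p3 {n m : ℕ}
    (Φ : Matrix (Fin n) (Fin n) ℂ →ₚ[ℂ] Matrix (Fin m) (Fin m) ℂ)
    (N : Matrix (Fin n) (Fin n) ℂ) (hN : IsStarNormal N) :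
    -- (a) `|Φ(N)| ≺_{w log} Φ(|N|)`
    WeakLogMajorized (CFC.abs (Φ N)) (Φ (CFC.abs N)) (posSemidef_abs (Φ N)) (posSemidef_map_abs Φ N) ∧
    -- (b) `λ_{j+k-1}(|Φ(N)|) ≤ √(λ_j(Φ(|N|)) λ_k(Φ(|N|)))`
    (∀ j k : ℕ, 1 ≤ j → 1 ≤ k →
      orderedEigenvalue (CFC.abs (Φ N)) (posSemidef_abs (Φ N)).isHermitian (j + k - 1) ≤
        √(orderedEigenvalue (Φ (CFC.abs N)) (posSemidef_map_abs Φ N).isHermitian j *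
          orderedEigenvalue (Φ (CFC.abs N)) (posSemidef_map_abs Φ N).isHermitian k)) ∧
    -- (c) `4β λ_j(|Φ(N)| - β Φ(|N|)) ≤ λ_j(Φ(|N|))`
    (∀ β : ℝ, 0 < β → ∀ j : ℕ, 1 ≤ j →
      4 * β * orderedEigenvalue (CFC.abs (Φ N) - β • Φ (CFC.abs N))
          (isHermitian_abs_map_sub_smul Φ N β) j ≤
        orderedEigenvalue (Φ (CFC.abs N)) (posSemidef_map_abs Φ N).isHermitian j) := by

  have hm : Module.finrank ℂ (EuclideanSpace ℂ (Fin m)) = m := by simp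
  have hPpos := posSemidef_abs (Φ N)
  have hBpos := posSemidef_map_abs Φ N
  have hP := Matrix.isSymmetric_toEuclideanLin_iff.mpr hPpos.isHermitian
  have hB := Matrix.isSymmetric_toEuclideanLin_iff.mpr hBpos.isHermitian
  have hP0 := (Matrix.isPositive_toEuclideanLin_iff.mpr hPpos).re_inner_nonneg_right
  have hB0 := (Matrix.isPositive_toEuclideanLin_iff.mpr hBpos).re_inner_nonneg_right
  obtain ⟨U, hU⟩ := exists_linearIsometry_comp_eq (Matrix.norm_toEuclideanLin_abs (Φ N))
  have h : ∀ x y, ‖inner ℂ x (Matrix.toEuclideanLin (CFC.abs (Φ N)) y)‖ ^ 2 ≤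
      (inner ℂ (U x) (Matrix.toEuclideanLin (Φ (CFC.abs N)) (U x))).re *
        (inner ℂ y (Matrix.toEuclideanLin (Φ (CFC.abs N)) y)).re := fun x y => by
    rw [← U.inner_map_map, hU]
    exact norm_inner_map_sq_le Φ N hN _ _
  refine ⟨fun k _ hk => ?_, fun j k hj hk => ?_, fun β hβ j hj => ?_⟩
  · have hprod : ∀ {A : Matrix (Fin m) (Fin m) ℂ} (hA : A.IsHermitian),
        ∏ i ∈ Finset.Icc 1 k, orderedEigenvalue A hA i =
          ∏ i : Fin k, (Matrix.isSymmetric_toEuclideanLin_iff.mpr hA).eigenvalues hm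
            (Fin.castLE hk i) := fun hA => by
      rw [← Finset.Ico_add_one_right_eq_Icc, Finset.prod_Ico_eq_prod_range, Nat.add_sub_cancel,
        Finset.prod_range]
      refine Finset.prod_congr rfl fun i _ => ?_
      rw [add_comm]
      exact orderedEigenvalue_eq_eigenvalues hA hm i (i.2.trans_le hk)
    rw [hprod, hprod]
    exact prod_eigenvalues_le hP hB U hm hP0 hB0 h hk
  · obtain ⟨j, rfl⟩ := Nat.exists_eq_add_of_le' hj
    obtain ⟨k, rfl⟩ := Nat.exists_eq_add_of_le' hk
    rw [show j + 1 + (k + 1) - 1 = j + k + 1 by omega]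
    rcases lt_or_ge (j + k) m with hjk | hjk
    · rw [orderedEigenvalue_eq_eigenvalues _ hm _ hjk,
        orderedEigenvalue_eq_eigenvalues _ hm j (by omega),
        orderedEigenvalue_eq_eigenvalues _ hm k (by omega)]
      exact eigenvalues_add_le_sqrt_mul hP hB U hm hB0 h hjk
    · rw [orderedEigenvalue_of_lt _ (by omega)]
      exact Real.sqrt_nonneg _
  · obtain ⟨j, rfl⟩ := Nat.exists_eq_add_of_le' hj
    rcases lt_or_ge j m with hjm | hjm
    · rw [orderedEigenvalue_eq_eigenvalues _ hm _ hjm, orderedEigenvalue_eq_eigenvalues _ hm _ hjm]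
      refine eigenvalues_sub_smul_le hB U hm hβ hB0 h _ ?_ ⟨j, hjm⟩
      rw [map_sub, ← Complex.coe_smul β (Φ (CFC.abs N)), map_smul Matrix.toEuclideanLin]
    · rw [orderedEigenvalue_of_lt _ (by omega), orderedEigenvalue_of_lt _ (by omega), mul_zero]
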